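/- Let $M,L\ge 1$, let $A\in\mathbb R^{L\times M}$ have full rank, let $\sigma>0$, and let $Y=AX+Z$, where $X\sim\mathcal N(0,I_M)$ and $Z\sim\mathcal N(0,\sigma^2I_L)$ are independent. Let $\lambda_1\ge\dots\ge\lambda_L\ge0$ be the eigenvalues of $AA^T$. All rates and mutual informations are in bits. For $R\ge0$ let the indirect distortion-rate function be $$D_{X|Y}(R)=\inf\ \frac1M\,\mathbb E\|X-\widehat X\|^2,$$ the infimum being over all joint laws of $(Y,\widehat X)$, where $Y$ has its given law, $\widehat X$ takes values in $\mathbb R^M$, $I(Y;\widehat X)\le R$, and $X-Y-\widehat X$ is a Markov chain. For a joint law $P$ of $(Y,\widehat Y)$, where $Y$ has its given law and $\widehat Y$ takes values in $\mathbb R^L$, let $$D_{CE}=\inf_g\ \frac1M\,\mathbb E\|X-g(\widehat Y)\|^2,$$ where $X-Y-\widehat Y$ is a Markov chain and $g$ ranges over all measurable estimators $\mathbb R^L\to\mathbb R^M$. The compress-and-estimate distortion-rate function $D_{CE}(R)$ is this quantity when $P$ is optimal for compressing $Y$ itself at rate $R$, that is, when $I(Y;\widehat Y)=R$ and $\mathbb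 E\|Y-\widehat Y\|^2$ equals the infimum of $\mathbb E\|Y-\widetilde Y\|^2$ over all joint laws of $(Y,\widetilde Y)$ with $I(Y;\widetilde Y)\le R$. Concretely, $P$ is given by the backward Gaussian channel $Y=\widehat Y+UN$, where $U$ is an orthogonal matrix with $U^T(AA^T+\sigma^2I)U=\mathrm{diag}(\lambda_l+\sigma^2)$, $N\sim\mathcal N(0,\mathrm{diag}(D_1,\dots,D_L))$ is independent of the centred Gaussian vector $\widehat Y$, $D_l=\min(\lambda_l+\sigma^2,\theta)$, and $\theta>0$ satisfies $\sum_{l=1}^L\frac12\log_2^+\frac{\lambda_l+\sigma^2}{\theta}=R$. Then for every $R\ge0$ both distortions are finite, and the gap $G(R)=D_{CE}(R)-D_{X|Y}(R)$ satisfies $$G(R)\ \le\ \frac LM\cdot\frac{\lambda_1+\sigma^2}{4\sigma^2}\cdot2^{-2R/L}.$$ The bound holds both for every optimal law $P$ as above and for the law given by the backward Gaussian channel. -/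

import Mathlib

open MeasureTheory ProbabilityTheory InformationTheory
open scoped ENNReal Matrix

noncomputable section

namespace RemoteCoding

/-- `ℝ^n` with the Euclidean norm. -/
abbrev Vec (n : ℕ) : Type := EuclideanSpace ℝ (Fin n)

variable {M L : ℕ}

/-- The matrix-vector product `A x`, as a map between Euclidean spaces. -/
def mulVecE {m n : ℕ} (A : Matrix (Fin m) (Fin n) ℝ) (x : Vec n) : Vec m :=
  Matrix.toEuclideanLin A x

lemma measurable_mulVecE {m n : ℕ} (A : Matrix (Fin m) (Fin n) ℝ) : Measurable (mulVecE A) :=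
  (LinearMap.continuous_of_finiteDimensional (Matrix.toEuclideanLin A)).measurable

/-! ### The source and its observation -/

/-- The joint law of `(X, Y)`, where `X ∼ N(0, I_M)`, `Z ∼ N(0, σ² I_L)` are independent and
`Y = A X + Z`. -/
def sourceObsLaw (A : Matrix (Fin L) (Fin M) ℝ) (σ : ℝ) : Measure (Vec M × Vec L) :=
  ((multivariateGaussian 0 (1 : Matrix (Fin M) (Fin M) ℝ)).prod
    (multivariateGaussian 0 (σ ^ 2 • (1 : Matrix (Fin L) (Fin L) ℝ)))).map
      (fun p => (p.1, mulVecE A p.1 + p.2))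

/-- The law of the observation `Y`. -/
def obsLaw (A : Matrix (Fin L) (Fin M) ℝ) (σ : ℝ) : Measure (Vec L) :=
  (sourceObsLaw A σ).snd

/-- The covariance matrix `Σ_Y = A Aᵀ + σ² I` of the observation. -/
def obsCov (A : Matrix (Fin L) (Fin M) ℝ) (σ : ℝ) : Matrix (Fin L) (Fin L) ℝ :=
  A * Aᵀ + σ ^ 2 • (1 : Matrix (Fin L) (Fin L) ℝ)

lemma isHermitian_gram (A : Matrix (Fin L) (Fin M) ℝ) : (A * Aᵀ).IsHermitian := by
  simpa using Matrix.isHermitian_mul_conjTranspose_self A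

/-- The eigenvalues of `A Aᵀ` with multiplicity, in descending order: `gramEig A 0` is the
largest one. -/
def gramEig (A : Matrix (Fin L) (Fin M) ℝ) (l : Fin L) : ℝ :=
  (isHermitian_gram A).eigenvalues₀ (Fin.cast (Fintype.card_fin L).symm l)

/-! ### Mutual information and distortion -/

/-- The mutual information, in bits, between the two components of a pair with joint law `ρ`. -/
def mutualInfo {α β : Type*} [MeasurableSpace α] [MeasurableSpace β] (ρ : Measure (α × β)) :
    ℝ≥0∞ :=
  klDiv ρ (ρ.fst.prod ρ.snd) / ENNReal.ofReal (Real.log 2)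

/-- Given a joint law `ρ` of `(Y, W)`, the law of `(X, W)` when `(X, Y)` has the law of the model
and `X – Y – W` is a Markov chain: `W` is drawn from the conditional law of `W` given `Y`. -/
def sourceReconLaw (A : Matrix (Fin L) (Fin M) ℝ) (σ : ℝ) {n : ℕ}
    (ρ : Measure (Vec L × Vec n)) [IsFiniteMeasure ρ] : Measure (Vec M × Vec n) :=
  ((sourceObsLaw A σ) ⊗ₘ (ρ.condKernel.comap Prod.snd measurable_snd)).map
    (fun p => (p.1.1, p.2))

/-- The distortion `(1/M) 𝔼 ‖X − g(W)‖²` for a pair `(X, W)` of law `τ`. -/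
def distortion {n : ℕ} (τ : Measure (Vec M × Vec n)) (g : Vec n → Vec M) : ℝ≥0∞ :=
  (∫⁻ p, ‖p.1 - g p.2‖ₑ ^ 2 ∂τ) / (M : ℝ≥0∞)

/-! ### The optimal indirect distortion-rate function -/

/-- The indirect distortion-rate function `D_{X|Y}(R)`: the infimum of `(1/M) 𝔼 ‖X − X̂‖²` over
all joint laws `ρ` of `(Y, X̂)` with `I(Y; X̂) ≤ R` bits (and `X – Y – X̂`). -/
def iDRF (A : Matrix (Fin L) (Fin M) ℝ) (σ R : ℝ) : ℝ≥0∞ :=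
  ⨅ (ρ : Measure (Vec L × Vec M)) (_ : IsProbabilityMeasure ρ) (_ : ρ.fst = obsLaw A σ)
    (_ : mutualInfo ρ ≤ ENNReal.ofReal R), distortion (sourceReconLaw A σ ρ) id

/-! ### Compress-and-estimate -/

/-- The (total) distortion-rate function of the observation `Y` itself under quadratic distortion:
the infimum of `𝔼 ‖Y − Ŷ‖²` over all joint laws `ρ` of `(Y, Ŷ)` with `I(Y; Ŷ) ≤ R` bits. -/
def obsDRF (A : Matrix (Fin L) (Fin M) ℝ) (σ R : ℝ) : ℝ≥0∞ :=
  ⨅ (ρ : Measure (Vec L × Vec L)) (_ : IsProbabilityMeasure ρ) (_ : ρ.fst = obsLaw A σ)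
    (_ : mutualInfo ρ ≤ ENNReal.ofReal R), ∫⁻ p, ‖p.1 - p.2‖ₑ ^ 2 ∂ρ

/-- `ρ` is a joint law of `(Y, Ŷ)` that is optimal for compressing `Y` at rate `R`. -/
structure IsLocallyOptimal (A : Matrix (Fin L) (Fin M) ℝ) (σ R : ℝ)
    (ρ : Measure (Vec L × Vec L)) : Prop where
  fst_eq : ρ.fst = obsLaw A σ
  rate_eq : mutualInfo ρ = ENNReal.ofReal R
  distortion_eq : ∫⁻ p, ‖p.1 - p.2‖ₑ ^ 2 ∂ρ = obsDRF A σ R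

/-- The compress-and-estimate distortion `D_CE` when `(Y, Ŷ)` has law `ρ`: the infimum of
`(1/M) 𝔼 ‖X − g(Ŷ)‖²` over all (measurable) estimators `g` of `X` from `Ŷ`. -/
def ceDRF (A : Matrix (Fin L) (Fin M) ℝ) (σ : ℝ) (ρ : Measure (Vec L × Vec L))
    [IsFiniteMeasure ρ] : ℝ≥0∞ :=
  ⨅ (g : Vec L → Vec M) (_ : Measurable g), distortion (sourceReconLaw A σ ρ) g

/-- The reverse water-filling distortions `D_l = min (λ_l + σ², θ)`. -/
def waterFill (A : Matrix (Fin L) (Fin M) ℝ) (σ θ : ℝ) (l : Fin L) : ℝ :=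
  min (gramEig A l + σ ^ 2) θ

/-- `θ` is a water level for the rate `R`: `∑_l ½ log⁺ ((λ_l + σ²) / θ) = R`, in bits. -/
def IsWaterLevel (A : Matrix (Fin L) (Fin M) ℝ) (σ R θ : ℝ) : Prop :=
  0 < θ ∧ ∑ l : Fin L, 1 / 2 * Real.logb 2 (max 1 ((gramEig A l + σ ^ 2) / θ)) = R

/-- `U` is an orthogonal matrix that diagonalizes `Σ_Y`, with the eigenvalues in descending
order. -/
def Diagonalizes (A : Matrix (Fin L) (Fin M) ℝ) (σ : ℝ) (U : Matrix (Fin L) (Fin L) ℝ) : Prop :=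
  U ∈ Matrix.orthogonalGroup (Fin L) ℝ ∧
    Uᵀ * obsCov A σ * U = Matrix.diagonal (fun l => gramEig A l + σ ^ 2)

/-- The joint law of `(Y, Ŷ)` given by the backward Gaussian channel `Y = Ŷ + U N`, where
`N ∼ N(0, diag(D_l))` is independent of the centred Gaussian vector `Ŷ`, whose covariance matrix
is `Σ_Y − U diag(D_l) Uᵀ`. -/
def backwardLaw (A : Matrix (Fin L) (Fin M) ℝ) (σ θ : ℝ) (U : Matrix (Fin L) (Fin L) ℝ) :
    Measure (Vec L × Vec L) :=
  ((multivariateGaussian 0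
      (obsCov A σ - U * Matrix.diagonal (waterFill A σ θ) * Uᵀ)).prod
    (multivariateGaussian 0 (Matrix.diagonal (waterFill A σ θ)))).map
      (fun p => (p.1 + mulVecE U p.2, p.1))

instance (A : Matrix (Fin L) (Fin M) ℝ) (σ θ : ℝ) (U : Matrix (Fin L) (Fin L) ℝ) :
    IsProbabilityMeasure (backwardLaw A σ θ U) :=
  Measure.isProbabilityMeasure_map
    (((measurable_fst.add ((measurable_mulVecE U).comp measurable_snd)).prodMk
      measurable_fst).aemeasurable)

/-- The gap between the compress-and-estimate distortion and the optimal indirect one. -/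
def gap (A : Matrix (Fin L) (Fin M) ℝ) (σ R : ℝ) (ρ : Measure (Vec L × Vec L))
    [IsFiniteMeasure ρ] : ℝ :=
  (ceDRF A σ ρ).toReal - (iDRF A σ R).toReal

end RemoteCoding

end

/-! Write `X = V + W Y` with `W = Aᵀ Σ_Y⁻¹`. The error `V` is uncorrelated with `Y`, hence
independent of it, and by the Markov property also of the pair of `Y` and any reconstruction. So
every distortion is the MMSE of `X` given `Y` plus the error in reproducing `W Y`
(`distortion_sourceReconLaw`). Dropping the second term bounds the optimum from below by the MMSE
(`le_iDRF`). Using `W Ŷ` as the estimator bounds compress-and-estimate from above, and the squared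
operator norm of `W` is at most `1 / (4σ²)` (`norm_sq_wiener_le`). The gap is therefore at most `𝔼‖Y
− Ŷ‖² / (4σ² M)`.

It remains to bound `𝔼‖Y − Ŷ‖²` by `L (λ₁ + σ²) 2^(-2R/L)`. For the backward channel this is a
direct estimate of the water-filling sum (`sum_waterFill_le`). For an arbitrary optimal law no
converse is needed: its distortion is an infimum, so one explicit test channel suffices
(`obsDRF_le`). That channel spends equal rate on each whitened coordinate, and its mutual
information comes from a one-dimensional Gaussian computation. -/

noncomputable section

namespace RemoteCoding

/-! ### Kullback–Leibler divergence of products and of exponential densities -/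

section KullbackLeibler

/-- The chain rule for constant kernels leaves a second term whose two measures share the first
factor; after a swap (data processing) that factor cancels. -/
lemma klDiv_prod_le {α β : Type*} [MeasurableSpace α] [MeasurableSpace β]
    (μ₁ ν₁ : Measure α) (μ₂ ν₂ : Measure β) [IsProbabilityMeasure μ₁] [IsProbabilityMeasure ν₁]
    [IsProbabilityMeasure μ₂] [IsProbabilityMeasure ν₂] :
    klDiv (μ₁.prod μ₂) (ν₁.prod ν₂) ≤ klDiv μ₁ ν₁ + klDiv μ₂ ν₂ := by
  rw [← Measure.compProd_const, ← Measure.compProd_const, klDiv_compProd_eq_add]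
  gcongr
  rw [Measure.compProd_const, Measure.compProd_const, ← Measure.prod_swap (μ := μ₂),
    ← Measure.prod_swap (μ := ν₂)]
  refine (klDiv_map_le _ _ measurable_swap).trans ?_
  rw [← Measure.compProd_const, ← Measure.compProd_const, klDiv_compProd_left]

lemma klDiv_pi_le {α : Type*} [MeasurableSpace α] (μ ν : Measure α) [IsProbabilityMeasure μ]
    [IsProbabilityMeasure ν] (n : ℕ) :
    klDiv (Measure.pi fun _ : Fin n => μ) (Measure.pi fun _ : Fin n => ν) ≤ n * klDiv μ ν := by
  induction n with
  | zero =>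
    rw [Measure.pi_of_empty, Measure.pi_of_empty, klDiv_self]
    exact zero_le
  | succ n ih =>
    have h (ξ : Measure α) [IsProbabilityMeasure ξ] :
        Measure.pi (fun _ : Fin (n + 1) => ξ) = (ξ.prod (Measure.pi fun _ : Fin n => ξ)).map
          (MeasurableEquiv.piFinSuccAbove (fun _ : Fin (n + 1) => α) 0).symm :=
      ((measurePreserving_piFinSuccAbove (fun _ : Fin (n + 1) => ξ) 0).symm _).map_eq.symm
    rw [h μ, h ν]
    refine (klDiv_map_le _ _ (MeasurableEquiv.measurable _)).trans
      ((klDiv_prod_le _ _ _ _).trans ?_)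
    push_cast
    rw [add_mul, one_mul, add_comm]
    gcongr

lemma klDiv_eq_of_withDensity_exp {α : Type*} [MeasurableSpace α] {μ ν : Measure α}
    [IsProbabilityMeasure μ] [IsProbabilityMeasure ν] {h : α → ℝ} (hm : Measurable h)
    (hμ : μ = ν.withDensity fun x => ENNReal.ofReal (Real.exp (h x))) (hi : Integrable h μ) :
    klDiv μ ν = ENNReal.ofReal (∫ x, h x ∂μ) := by
  have hac : μ ≪ ν := hμ ▸ withDensity_absolutelyContinuous _ _
  have hllr : llr μ ν =ᵐ[μ] h := by
    refine hac.ae_le ?_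
    have := Measure.rnDeriv_withDensity ν (f := fun x => ENNReal.ofReal (Real.exp (h x)))
      (by fun_prop)
    rw [← hμ] at this
    filter_upwards [this] with x hx
    rw [llr_def]
    simp only [hx]
    rw [ENNReal.toReal_ofReal (Real.exp_pos _).le, Real.log_exp]
  rw [klDiv_of_ac_of_integrable hac (hi.congr hllr.symm), integral_congr_ae hllr]
  simp

end KullbackLeibler

/-! ### The standard Gaussian test channel and its mutual information -/

section StandardPair

/-- The law of `(G, s G + t G')` for independent standard Gaussian variables `G`, `G'`. -/
def stdPairReal (s t : ℝ) : Measure (ℝ × ℝ) :=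
  ((gaussianReal 0 1).prod (gaussianReal 0 1)).map (fun p => (p.1, s * p.1 + t * p.2))

instance (s t : ℝ) : IsProbabilityMeasure (stdPairReal s t) :=
  Measure.isProbabilityMeasure_map (by fun_prop)

/-- The log-density of `N(s x, t²)` with respect to `N(0, 1)`. -/
def stdPairLogDensity (s t : ℝ) (p : ℝ × ℝ) : ℝ :=
  -Real.log t - (p.2 - s * p.1) ^ 2 / (2 * t ^ 2) + p.2 ^ 2 / 2

lemma measurable_stdPairLogDensity (s t : ℝ) : Measurable (stdPairLogDensity s t) := by
  unfold stdPairLogDensity; fun_prop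

lemma gaussianReal_eq_withDensity_stdGaussian (s : ℝ) {t : ℝ} (ht : 0 < t) (x : ℝ) :
    (gaussianReal 0 1).map (fun n => s * x + t * n) = (gaussianReal 0 1).withDensity
      (fun w => ENNReal.ofReal (Real.exp (stdPairLogDensity s t (x, w)))) := by
  have h1 : (gaussianReal 0 1).map (fun n => s * x + t * n)
      = gaussianReal (s * x) (.mk (t ^ 2) (sq_nonneg _)) := by
    have : (fun n => s * x + t * n) = (fun n => s * x + n) ∘ (fun n => t * n) := rfl
    rw [this, ← Measure.map_map (by fun_prop) (by fun_prop), gaussianReal_map_const_mul,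
      gaussianReal_map_const_add]
    simp
  have hv : (NNReal.mk (t ^ 2) (sq_nonneg _)) ≠ 0 := by
    intro h; exact (pow_pos ht 2).ne' (congrArg NNReal.toReal h)
  rw [h1, gaussianReal_of_var_ne_zero _ hv, gaussianReal_of_var_ne_zero _ one_ne_zero,
    ← withDensity_mul _ (measurable_gaussianPDF _ _)
      (by have := measurable_stdPairLogDensity s t; fun_prop)]
  congr 1
  ext w
  simp only [Pi.mul_apply, gaussianPDF, gaussianPDFReal]
  rw [← ENNReal.ofReal_mul (by positivity)]
  congr 1
  have e1 : √(2 * Real.pi * ((NNReal.mk (t ^ 2) (sq_nonneg _) : NNReal) : ℝ))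
      = √(2 * Real.pi) * t := by
    rw [NNReal.coe_mk, Real.sqrt_mul (by positivity), Real.sqrt_sq ht.le]
  rw [e1]
  simp only [stdPairLogDensity, NNReal.coe_mk, NNReal.coe_one, mul_one, sub_zero, mul_inv]
  rw [mul_assoc, mul_assoc, ← Real.exp_add]
  congr 1
  -- The ratio of the normalizing constants, `t⁻¹`, is absorbed into the exponent as `-log t`.
  rw [show t⁻¹ = Real.exp (-Real.log t) by rw [Real.exp_neg, Real.exp_log ht], ← Real.exp_add]
  congr 1
  ring

lemma stdPairReal_eq_withDensity (s : ℝ) {t : ℝ} (ht : 0 < t) :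
    stdPairReal s t = ((gaussianReal 0 1).prod (gaussianReal 0 1)).withDensity
      (fun p => ENNReal.ofReal (Real.exp (stdPairLogDensity s t p))) := by
  have hm := measurable_stdPairLogDensity s t
  refine Measure.ext_of_lintegral _ fun f hf => ?_
  rw [stdPairReal, lintegral_map hf (by fun_prop), lintegral_prod _ (by fun_prop),
    lintegral_withDensity_eq_lintegral_mul _ (by fun_prop) hf, lintegral_prod _ (by fun_prop)]
  refine lintegral_congr fun x => ?_
  have h := gaussianReal_eq_withDensity_stdGaussian s ht x
  have h2 := congrArg (fun m => ∫⁻ w, f (x, w) ∂m) h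
  rw [lintegral_map (by fun_prop) (by fun_prop),
    lintegral_withDensity_eq_lintegral_mul _ (by fun_prop) (by fun_prop)] at h2
  simpa using h2

lemma integral_sq_gaussianReal : ∫ x, x ^ 2 ∂(gaussianReal 0 1) = 1 := by
  have h := variance_id_gaussianReal (μ := 0) (v := 1)
  rw [variance_of_integral_eq_zero (by fun_prop) (by simp)] at h
  simpa using h

lemma integrable_sq_gaussianReal : Integrable (fun x : ℝ => x ^ 2) (gaussianReal 0 1) :=
  (memLp_id_gaussianReal (μ := 0) (v := 1) 2).integrable_sq

/-- Under the joint law the quadratic part of the log-density has mean `s²/2 + (t² − 1)/2 = 0`, and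
the cross term has mean zero by independence, so only `-log t` survives. -/
lemma klDiv_stdPairReal {s t : ℝ} (ht : 0 < t) (hst : s ^ 2 + t ^ 2 = 1) :
    klDiv (stdPairReal s t) ((gaussianReal 0 1).prod (gaussianReal 0 1))
      = ENNReal.ofReal (-Real.log t) := by
  have hm := measurable_stdPairLogDensity s t
  have hcomp : (stdPairLogDensity s t) ∘ (fun p : ℝ × ℝ => (p.1, s * p.1 + t * p.2))
      = fun p => -Real.log t + (s ^ 2 / 2) * p.1 ^ 2 + (t ^ 2 / 2 - 1 / 2) * p.2 ^ 2
          + s * t * (p.1 * p.2) := by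
    ext p
    simp only [stdPairLogDensity, Function.comp]
    field_simp
    ring
  have i1 : Integrable (fun p : ℝ × ℝ => p.1 ^ 2) ((gaussianReal 0 1).prod (gaussianReal 0 1)) :=
    integrable_sq_gaussianReal.comp_fst _
  have i2 : Integrable (fun p : ℝ × ℝ => p.2 ^ 2) ((gaussianReal 0 1).prod (gaussianReal 0 1)) :=
    integrable_sq_gaussianReal.comp_snd _
  have iid : Integrable (fun x : ℝ => x) (gaussianReal 0 1) :=
    (memLp_id_gaussianReal (μ := 0) (v := 1) 1).integrable le_rfl
  have i3 : Integrable (fun p : ℝ × ℝ => p.1 * p.2)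
      ((gaussianReal 0 1).prod (gaussianReal 0 1)) := iid.mul_prod iid
  have j1 : Integrable (fun p : ℝ × ℝ => -Real.log t + (s ^ 2 / 2) * p.1 ^ 2)
      ((gaussianReal 0 1).prod (gaussianReal 0 1)) := (integrable_const _).add (i1.const_mul _)
  have j2 : Integrable (fun p : ℝ × ℝ =>
      -Real.log t + (s ^ 2 / 2) * p.1 ^ 2 + (t ^ 2 / 2 - 1 / 2) * p.2 ^ 2)
      ((gaussianReal 0 1).prod (gaussianReal 0 1)) := j1.add (i2.const_mul _)
  rw [klDiv_eq_of_withDensity_exp hm (stdPairReal_eq_withDensity s ht)]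
  · rw [stdPairReal, integral_map (by fun_prop) hm.aestronglyMeasurable]
    congr 1
    have : ∀ p : ℝ × ℝ, stdPairLogDensity s t (p.1, s * p.1 + t * p.2) = _ :=
      fun p => congrFun hcomp p
    simp_rw [this]
    rw [integral_add j2 (i3.const_mul _), integral_add j1 (i2.const_mul _),
      integral_add (integrable_const _) (i1.const_mul _), integral_const_mul, integral_const_mul,
      integral_const_mul, integral_prod_mul (f := fun x : ℝ => x) (g := fun x : ℝ => x),
      integral_fun_fst (fun x : ℝ => x ^ 2),
      integral_fun_snd (fun x : ℝ => x ^ 2), integral_sq_gaussianReal]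
    simp
    linarith
  · rw [stdPairReal, integrable_map_measure hm.aestronglyMeasurable (by fun_prop), hcomp]
    exact j2.add (i3.const_mul _)

/-- The map that turns a family of pairs of reals into a pair of vectors. -/
def pairUp (L : ℕ) (f : Fin L → ℝ × ℝ) : Vec L × Vec L :=
  (WithLp.toLp 2 fun i => (f i).1, WithLp.toLp 2 fun i => (f i).2)

lemma measurable_pairUp (L : ℕ) : Measurable (pairUp L) := by
  unfold pairUp; fun_prop

lemma stdGaussian_prod_eq_map_pairUp (L : ℕ) :
    (stdGaussian (Vec L)).prod (stdGaussian (Vec L)) =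
      (Measure.pi fun _ : Fin L => (gaussianReal 0 1).prod (gaussianReal 0 1)).map (pairUp L) := by
  have h := (measurePreserving_arrowProdEquivProdArrow ℝ ℝ (Fin L)
    (fun _ => gaussianReal 0 1) (fun _ => gaussianReal 0 1)).map_eq
  rw [← map_pi_eq_stdGaussian, Measure.map_prod_map _ _ (by fun_prop) (by fun_prop), ← h,
    Measure.map_map (by fun_prop) (by fun_prop)]
  rfl

/-- The law of `(G, s G + t G')` for independent standard Gaussian vectors `G`, `G'`. -/
def stdPair (L : ℕ) (s t : ℝ) : Measure (Vec L × Vec L) :=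
  ((stdGaussian (Vec L)).prod (stdGaussian (Vec L))).map (fun p => (p.1, s • p.1 + t • p.2))

instance (L : ℕ) (s t : ℝ) : IsProbabilityMeasure (stdPair L s t) :=
  Measure.isProbabilityMeasure_map (by fun_prop)

/-- Coordinates decouple, which reduces the divergence of the vector channel to `L` copies of the
scalar one. -/
lemma stdPair_eq_map_pairUp (L : ℕ) (s t : ℝ) :
    stdPair L s t = (Measure.pi fun _ : Fin L => stdPairReal s t).map (pairUp L) := by
  have hp := measurable_pairUp L
  rw [stdPair, stdGaussian_prod_eq_map_pairUp, Measure.map_map (by fun_prop) hp]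
  have : (fun _ : Fin L => stdPairReal s t) = fun _ =>
    ((gaussianReal 0 1).prod (gaussianReal 0 1)).map (fun p => (p.1, s * p.1 + t * p.2)) := rfl
  rw [this, ← Measure.pi_map_pi (fun _ => by fun_prop), Measure.map_map hp (by fun_prop)]
  rfl

lemma klDiv_stdPair_le (L : ℕ) {s t : ℝ} (ht : 0 < t) (hst : s ^ 2 + t ^ 2 = 1) :
    klDiv (stdPair L s t) ((stdGaussian (Vec L)).prod (stdGaussian (Vec L)))
      ≤ L * ENNReal.ofReal (-Real.log t) := by
  rw [stdPair_eq_map_pairUp, stdGaussian_prod_eq_map_pairUp, ← klDiv_stdPairReal ht hst]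
  exact (klDiv_map_le _ _ (measurable_pairUp L)).trans (klDiv_pi_le _ _ L)

/-- Characteristic functions multiply and `a² + b² = 1`. This gives both the output marginal of the
test channel and the law of its error. -/
lemma stdGaussian_prod_map_add {L : ℕ} {a b : ℝ} (hab : a ^ 2 + b ^ 2 = 1) :
    ((stdGaussian (Vec L)).prod (stdGaussian (Vec L))).map (fun p => a • p.1 + b • p.2)
      = stdGaussian (Vec L) := by
  have h : (fun p : Vec L × Vec L => a • p.1 + b • p.2)
    = (fun p => p.1 + p.2) ∘ Prod.map (fun x => a • x) (fun x => b • x) := rfl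
  rw [h, ← Measure.map_map (by fun_prop) (by fun_prop),
    ← Measure.map_prod_map _ _ (by fun_prop) (by fun_prop)]
  have := Measure.isProbabilityMeasure_map (μ := stdGaussian (Vec L)) (f := fun x => a • x)
    (by fun_prop)
  have := Measure.isProbabilityMeasure_map (μ := stdGaussian (Vec L)) (f := fun x => b • x)
    (by fun_prop)
  refine Measure.ext_of_charFun ?_
  ext u
  rw [charFun_map_add_prod_eq_mul]
  simp only [Pi.mul_apply, charFun_map_smul, charFun_stdGaussian]
  rw [← Complex.exp_add]
  congr 1
  have : (a : ℂ) ^ 2 + (b : ℂ) ^ 2 = 1 := by exact_mod_cast hab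
  simp only [norm_smul, Real.norm_eq_abs, Complex.ofReal_mul, mul_pow, ← Complex.ofReal_pow,
    sq_abs]
  push_cast
  linear_combination (-((‖u‖ : ℂ) ^ 2) / 2) * this

lemma snd_stdPair (L : ℕ) {s t : ℝ} (hst : s ^ 2 + t ^ 2 = 1) :
    (stdPair L s t).snd = stdGaussian (Vec L) := by
  rw [Measure.snd, stdPair, Measure.map_map (by fun_prop) (by fun_prop)]
  exact stdGaussian_prod_map_add hst

lemma fst_stdPair (L : ℕ) (s t : ℝ) : (stdPair L s t).fst = stdGaussian (Vec L) := by
  rw [Measure.fst, stdPair, Measure.map_map (by fun_prop) (by fun_prop)]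
  exact Measure.fst_prod

end StandardPair

/-- Applying maps to both components does not increase the mutual information. -/
lemma mutualInfo_map_le {α β α' β' : Type*} [MeasurableSpace α] [MeasurableSpace β]
    [MeasurableSpace α'] [MeasurableSpace β'] (ρ : Measure (α × β)) [IsProbabilityMeasure ρ]
    {f : α → α'} {g : β → β'} (hf : Measurable f) (hg : Measurable g) :
    mutualInfo (ρ.map (Prod.map f g)) ≤ mutualInfo ρ := by
  unfold mutualInfo
  gcongr
  have h : (ρ.map (Prod.map f g)).fst.prod (ρ.map (Prod.map f g)).snd
      = (ρ.fst.prod ρ.snd).map (Prod.map f g) := by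
    rw [← Measure.map_prod_map _ _ hf hg, Measure.fst, Measure.snd, Measure.fst, Measure.snd,
      Measure.map_map measurable_fst (by fun_prop), Measure.map_map measurable_snd (by fun_prop),
      Measure.map_map hf measurable_fst, Measure.map_map hg measurable_snd]
    rfl
  rw [h]
  exact klDiv_map_le _ _ (by fun_prop)

lemma mutualInfo_stdPair_le (L : ℕ) {s t : ℝ} (ht : 0 < t) (hst : s ^ 2 + t ^ 2 = 1) :
    mutualInfo (stdPair L s t)
      ≤ L * ENNReal.ofReal (-Real.log t) / ENNReal.ofReal (Real.log 2) := by
  unfold mutualInfo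
  rw [fst_stdPair, snd_stdPair L hst]
  gcongr
  exact klDiv_stdPair_le L ht hst

end RemoteCoding

namespace RemoteCoding

variable {M L : ℕ}

/-! ### Matrices acting on Euclidean spaces -/

section MulVec

variable {m n k : ℕ}

lemma ofLp_mulVecE (A : Matrix (Fin m) (Fin n) ℝ) (x : Vec n) :
    (mulVecE A x).ofLp = A *ᵥ x.ofLp := Matrix.ofLp_toLpLin 2 2 A x

lemma mulVecE_add (A : Matrix (Fin m) (Fin n) ℝ) (x y : Vec n) :
    mulVecE A (x + y) = mulVecE A x + mulVecE A y := map_add _ x y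

lemma mulVecE_sub (A : Matrix (Fin m) (Fin n) ℝ) (x y : Vec n) :
    mulVecE A (x - y) = mulVecE A x - mulVecE A y := map_sub _ x y

lemma mulVecE_mul (A : Matrix (Fin m) (Fin n) ℝ) (B : Matrix (Fin n) (Fin k) ℝ) (x : Vec k) :
    mulVecE (A * B) x = mulVecE A (mulVecE B x) := by
  apply WithLp.ofLp_injective 2
  simp [ofLp_mulVecE]

lemma mulVecE_one (x : Vec n) : mulVecE (1 : Matrix (Fin n) (Fin n) ℝ) x = x := by
  apply WithLp.ofLp_injective 2
  simp [ofLp_mulVecE]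

lemma matrix_sub_mulVecE (A B : Matrix (Fin m) (Fin n) ℝ) (x : Vec n) :
    mulVecE (A - B) x = mulVecE A x - mulVecE B x := by
  apply WithLp.ofLp_injective 2
  simp [ofLp_mulVecE, Matrix.sub_mulVec]

lemma matrix_add_mulVecE (A B : Matrix (Fin m) (Fin n) ℝ) (x : Vec n) :
    mulVecE (A + B) x = mulVecE A x + mulVecE B x := by
  apply WithLp.ofLp_injective 2
  simp [ofLp_mulVecE, Matrix.add_mulVec]

lemma matrix_smul_mulVecE (c : ℝ) (A : Matrix (Fin m) (Fin n) ℝ) (x : Vec n) :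
    mulVecE (c • A) x = c • mulVecE A x := by
  apply WithLp.ofLp_injective 2
  simp [ofLp_mulVecE, Matrix.smul_mulVec]

lemma matrix_neg_mulVecE (A : Matrix (Fin m) (Fin n) ℝ) (x : Vec n) :
    mulVecE (-A) x = -mulVecE A x := by
  apply WithLp.ofLp_injective 2
  simp [ofLp_mulVecE, Matrix.neg_mulVec]

lemma inner_mulVecE_left (A : Matrix (Fin m) (Fin n) ℝ) (x : Vec n) (y : Vec m) :
    inner ℝ (mulVecE A x) y = inner ℝ x (mulVecE Aᵀ y) := by
  have h := Matrix.toEuclideanLin_conjTranspose_eq_adjoint (𝕜 := ℝ) A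
  rw [Matrix.conjTranspose_eq_transpose_of_trivial] at h
  rw [mulVecE, mulVecE, h, LinearMap.adjoint_inner_right]

lemma norm_mulVecE_of_mem_orthogonalGroup {U : Matrix (Fin n) (Fin n) ℝ}
    (hU : U ∈ Matrix.orthogonalGroup (Fin n) ℝ) (x : Vec n) : ‖mulVecE U x‖ = ‖x‖ := by
  have h : Uᵀ * U = 1 := by
    simpa [Matrix.star_eq_conjTranspose] using Matrix.UnitaryGroup.star_mul_self ⟨U, hU⟩
  rw [← sq_eq_sq₀ (norm_nonneg _) (norm_nonneg _), ← real_inner_self_eq_norm_sq,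
    ← real_inner_self_eq_norm_sq, inner_mulVecE_left, ← mulVecE_mul, h, mulVecE_one]

end MulVec

/-! ### Linear images and second moments of Gaussian vectors -/

section Gaussian

variable {m n k l : ℕ}

lemma dotProduct_mulVec_transpose (P : Matrix (Fin k) (Fin m) ℝ) (S : Matrix (Fin m) (Fin m) ℝ)
    (Q : Matrix (Fin l) (Fin m) ℝ) (t : Fin k → ℝ) (u : Fin l → ℝ) :
    (Pᵀ *ᵥ t) ⬝ᵥ (S *ᵥ (Qᵀ *ᵥ u)) = t ⬝ᵥ ((P * S * Qᵀ) *ᵥ u) := by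
  rw [Matrix.mulVec_transpose, ← Matrix.dotProduct_mulVec, Matrix.mulVec_mulVec,
    Matrix.mulVec_mulVec, Matrix.mul_assoc]

/-- Two linear images of a pair of independent centred Gaussian vectors are independent as soon as
they are uncorrelated. -/
lemma multivariateGaussian_prod_map {S : Matrix (Fin m) (Fin m) ℝ} {T : Matrix (Fin n) (Fin n) ℝ}
    (hS : S.PosSemidef) (hT : T.PosSemidef)
    (P : Matrix (Fin k) (Fin m) ℝ) (Q : Matrix (Fin k) (Fin n) ℝ)
    (P' : Matrix (Fin l) (Fin m) ℝ) (Q' : Matrix (Fin l) (Fin n) ℝ)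
    (h : P * S * P'ᵀ + Q * T * Q'ᵀ = 0) :
    ((multivariateGaussian 0 S).prod (multivariateGaussian 0 T)).map
      (fun p => (mulVecE P p.1 + mulVecE Q p.2, mulVecE P' p.1 + mulVecE Q' p.2)) =
    (multivariateGaussian 0 (P * S * Pᵀ + Q * T * Qᵀ)).prod
      (multivariateGaussian 0 (P' * S * P'ᵀ + Q' * T * Q'ᵀ)) := by
  have hm (a b : ℕ) (C : Matrix (Fin a) (Fin b) ℝ) : Measurable (mulVecE C) := measurable_mulVecE C
  have h1 : (P * S * Pᵀ + Q * T * Qᵀ).PosSemidef := by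
    simpa using (hS.mul_mul_conjTranspose_same P).add (hT.mul_mul_conjTranspose_same Q)
  have h2 : (P' * S * P'ᵀ + Q' * T * Q'ᵀ).PosSemidef := by
    simpa using (hS.mul_mul_conjTranspose_same P').add (hT.mul_mul_conjTranspose_same Q')
  have hS' : Sᵀ = S := by simpa using hS.isHermitian.eq
  have hT' : Tᵀ = T := by simpa using hT.isHermitian.eq
  have h' : P' * S * Pᵀ + Q' * T * Qᵀ = 0 := by
    have := congrArg Matrix.transpose h
    simpa [Matrix.transpose_mul, hS', hT', Matrix.mul_assoc] using this
  have hF : Measurable (fun p : Vec m × Vec n =>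
      (mulVecE P p.1 + mulVecE Q p.2, mulVecE P' p.1 + mulVecE Q' p.2)) := by
    have := hm _ _ P; have := hm _ _ Q; have := hm _ _ P'; have := hm _ _ Q'
    fun_prop
  have := Measure.isProbabilityMeasure_map (μ := (multivariateGaussian 0 S).prod
    (multivariateGaussian 0 T)) hF.aemeasurable
  rw [← charFun_eq_prod_iff]
  intro t
  -- Moving the matrices across the inner product and factoring over the independent inputs
  -- expresses the joint characteristic function through the two known ones.
  have key : charFun ((((multivariateGaussian 0 S).prod (multivariateGaussian 0 T)).map
      (fun p => (mulVecE P p.1 + mulVecE Q p.2, mulVecE P' p.1 + mulVecE Q' p.2))).map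
        (WithLp.toLp 2)) t =
      charFun (multivariateGaussian 0 S) (mulVecE Pᵀ t.ofLp.1 + mulVecE P'ᵀ t.ofLp.2) *
      charFun (multivariateGaussian 0 T) (mulVecE Qᵀ t.ofLp.1 + mulVecE Q'ᵀ t.ofLp.2) := by
    rw [Measure.map_map (by fun_prop) hF]
    simp_rw [charFun]
    rw [integral_map ((WithLp.measurable_toLp 2 _).comp hF).aemeasurable
      (Measurable.aestronglyMeasurable (by fun_prop)), ← integral_prod_mul]
    refine integral_congr_ae (ae_of_all _ fun p => ?_)
    simp only [Function.comp, WithLp.prod_inner_apply, inner_add_left, inner_add_right,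
      inner_mulVecE_left]
    rw [← Complex.exp_add]
    congr 1
    push_cast
    ring
  rw [key, charFun_multivariateGaussian hS, charFun_multivariateGaussian hT,
    charFun_multivariateGaussian h1, charFun_multivariateGaussian h2, ← Complex.exp_add,
    ← Complex.exp_add]
  congr 1
  simp only [inner_zero_right, Complex.ofReal_zero, zero_mul, zero_sub, WithLp.ofLp_add,
    ofLp_mulVecE, add_dotProduct, dotProduct_add, Matrix.mulVec_add, dotProduct_mulVec_transpose,
    Matrix.add_mulVec]
  set a := t.ofLp.1.ofLp
  set b := t.ofLp.2.ofLp
  -- The mixed terms of the quadratic form are the cross-covariances, which vanish by hypothesis.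
  have c1 : a ⬝ᵥ ((P * S * P'ᵀ) *ᵥ b) + a ⬝ᵥ ((Q * T * Q'ᵀ) *ᵥ b) = 0 := by
    rw [← dotProduct_add, ← Matrix.add_mulVec, h]; simp
  have c2 : b ⬝ᵥ ((P' * S * Pᵀ) *ᵥ a) + b ⬝ᵥ ((Q' * T * Qᵀ) *ᵥ a) = 0 := by
    rw [← dotProduct_add, ← Matrix.add_mulVec, h']; simp
  have d1 := congrArg (fun x : ℝ => (x : ℂ)) c1
  have d2 := congrArg (fun x : ℝ => (x : ℂ)) c2
  push_cast at d1 d2 ⊢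
  linear_combination (-1 / 2 : ℂ) * d1 - (1 / 2 : ℂ) * d2

lemma multivariateGaussian_prod_map_add {S : Matrix (Fin m) (Fin m) ℝ}
    {T : Matrix (Fin n) (Fin n) ℝ} (hS : S.PosSemidef) (hT : T.PosSemidef)
    (P : Matrix (Fin k) (Fin m) ℝ) (Q : Matrix (Fin k) (Fin n) ℝ) :
    ((multivariateGaussian 0 S).prod (multivariateGaussian 0 T)).map
      (fun p => mulVecE P p.1 + mulVecE Q p.2) =
    multivariateGaussian 0 (P * S * Pᵀ + Q * T * Qᵀ) := by
  -- A zero second image is trivially uncorrelated with the first.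
  have h := congrArg Measure.fst
    (multivariateGaussian_prod_map hS hT P Q (0 : Matrix (Fin k) (Fin m) ℝ) 0 (by simp))
  have := measurable_mulVecE P
  have := measurable_mulVecE Q
  have := measurable_mulVecE (0 : Matrix (Fin k) (Fin m) ℝ)
  have := measurable_mulVecE (0 : Matrix (Fin k) (Fin n) ℝ)
  rw [Measure.fst_prod, Measure.fst, Measure.map_map (by fun_prop) (by fun_prop)] at h
  exact h

lemma lintegral_sq_enorm_multivariateGaussian {S : Matrix (Fin n) (Fin n) ℝ} (hS : S.PosSemidef) :
    ∫⁻ x, ‖x‖ₑ ^ 2 ∂(multivariateGaussian 0 S) = ENNReal.ofReal S.trace := by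
  have hmem : MemLp (fun x : Vec n => x) 2 (multivariateGaussian 0 S) := IsGaussian.memLp_two_id
  have hi (i : Fin n) : MemLp (fun x : Vec n => x i) 2 (multivariateGaussian 0 S) :=
    hmem.continuousLinearMap_comp (EuclideanSpace.proj (𝕜 := ℝ) i)
  have h0 (i : Fin n) : ∫ x : Vec n, x i ∂(multivariateGaussian 0 S) = 0 := by
    have := (EuclideanSpace.proj (𝕜 := ℝ) i).integral_comp_comm (hmem.integrable one_le_two)
    simpa using this
  have h1 : ∫ x, ‖x‖ ^ 2 ∂(multivariateGaussian 0 S) = S.trace := by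
    simp_rw [EuclideanSpace.real_norm_sq_eq]
    rw [integral_finsetSum _ fun i _ => (hi i).integrable_sq]
    refine Finset.sum_congr rfl fun i _ => ?_
    rw [Matrix.diag_apply, ← variance_eval_multivariateGaussian (μ := 0) hS i,
      variance_of_integral_eq_zero (hi i).aemeasurable (h0 i)]
  rw [← h1, ofReal_integral_eq_lintegral_ofReal hmem.norm.integrable_sq
    (ae_of_all _ fun x => by positivity)]
  refine lintegral_congr fun x => ?_
  rw [ENNReal.ofReal_pow (norm_nonneg _), ofReal_norm]

/-- Bias-variance decomposition for a centred Gaussian vector. -/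
lemma lintegral_sq_enorm_add_multivariateGaussian (S : Matrix (Fin n) (Fin n) ℝ) (a : Vec n) :
    ∫⁻ x, ‖x + a‖ₑ ^ 2 ∂(multivariateGaussian 0 S)
      = ∫⁻ x, ‖x‖ₑ ^ 2 ∂(multivariateGaussian 0 S) + ‖a‖ₑ ^ 2 := by
  have hmem : MemLp (fun x : Vec n => x) 2 (multivariateGaussian 0 S) := IsGaussian.memLp_two_id
  have hmem' : MemLp (fun x : Vec n => x + a) 2 (multivariateGaussian 0 S) :=
    hmem.add (memLp_const a)
  have hin : ∫ x : Vec n, inner ℝ x a ∂(multivariateGaussian 0 S) = 0 := by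
    simp_rw [real_inner_comm a]
    rw [integral_inner (hmem.integrable one_le_two)]
    simp
  have hii : Integrable (fun x : Vec n => inner ℝ x a) (multivariateGaussian 0 S) :=
    (hmem.integrable one_le_two).inner_const a
  have e (f : Vec n → Vec n) (hf : MemLp f 2 (multivariateGaussian 0 S)) :
      ∫⁻ x, ‖f x‖ₑ ^ 2 ∂(multivariateGaussian 0 S)
        = ENNReal.ofReal (∫ x, ‖f x‖ ^ 2 ∂(multivariateGaussian 0 S)) := by
    rw [ofReal_integral_eq_lintegral_ofReal hf.norm.integrable_sq
      (ae_of_all _ fun x => by positivity)]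
    refine lintegral_congr fun x => ?_
    rw [ENNReal.ofReal_pow (norm_nonneg _), ofReal_norm]
  have hsq : Integrable (fun x : Vec n => ‖x‖ ^ 2) (multivariateGaussian 0 S) :=
    hmem.norm.integrable_sq
  have j : Integrable (fun x : Vec n => ‖x‖ ^ 2 + 2 * inner ℝ x a) (multivariateGaussian 0 S) :=
    hsq.add (hii.const_mul 2)
  rw [e _ hmem', e _ hmem, ← ofReal_norm, ← ENNReal.ofReal_pow (norm_nonneg _),
    ← ENNReal.ofReal_add (integral_nonneg fun x => by positivity) (by positivity)]
  congr 1
  simp_rw [norm_add_sq_real]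
  rw [integral_add j (integrable_const _), integral_add hsq (hii.const_mul 2), integral_const_mul,
    hin]
  simp

lemma lintegral_sq_enorm_multivariateGaussian_ne_top (S : Matrix (Fin n) (Fin n) ℝ) :
    ∫⁻ x, ‖x‖ₑ ^ 2 ∂(multivariateGaussian 0 S) ≠ ⊤ := by
  have hmem : MemLp (fun x : Vec n => x) 2 (multivariateGaussian 0 S) := IsGaussian.memLp_two_id
  have h := (hmem.norm.integrable_sq).lintegral_lt_top
  refine (lt_of_eq_of_lt (lintegral_congr fun x => ?_) h).ne
  rw [ENNReal.ofReal_pow (norm_nonneg _), ofReal_norm]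

end Gaussian

end RemoteCoding

namespace RemoteCoding

variable {M L : ℕ}

/-! ### Estimating `X` from `Y`, and the gap in terms of `𝔼‖Y − Ŷ‖²` -/

section Model

variable (A : Matrix (Fin L) (Fin M) ℝ) {σ : ℝ}

lemma posSemidef_gram : (A * Aᵀ).PosSemidef := by
  simpa using Matrix.posSemidef_self_mul_conjTranspose A

lemma posDef_obsCov (hσ : 0 < σ) : (obsCov A σ).PosDef :=
  (Matrix.PosDef.one.smul (pow_pos hσ 2)).posSemidef_add (posSemidef_gram A)

lemma isUnit_det_obsCov (hσ : 0 < σ) : IsUnit (obsCov A σ).det :=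
  (Matrix.isUnit_iff_isUnit_det _).1 (posDef_obsCov A hσ).isUnit

lemma gramEig_nonneg (l : Fin L) : 0 ≤ gramEig A l := by
  have h := (posSemidef_gram A).eigenvalues_nonneg
    ((Fintype.equivOfCardEq (Fintype.card_fin _)) (Fin.cast (Fintype.card_fin L).symm l))
  simpa [Matrix.IsHermitian.eigenvalues, gramEig] using h

lemma gramEig_le_gramEig_zero (hL : 0 < L) (l : Fin L) : gramEig A l ≤ gramEig A ⟨0, hL⟩ :=
  (isHermitian_gram A).eigenvalues₀_antitone (by simp [Fin.le_def])

lemma sum_gramEig : ∑ l, gramEig A l = (A * Aᵀ).trace := by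
  rw [(isHermitian_gram A).trace_eq_sum_eigenvalues]
  simp only [Matrix.IsHermitian.eigenvalues, RCLike.ofReal_real_eq_id, id]
  rw [Equiv.sum_comp (Fintype.equivOfCardEq (Fintype.card_fin _)).symm
    (fun i => (isHermitian_gram A).eigenvalues₀ i)]
  exact Equiv.sum_comp (finCongr (Fintype.card_fin L).symm)
    (fun i => (isHermitian_gram A).eigenvalues₀ i)

lemma trace_obsCov_le (σ : ℝ) (hL : 0 < L) :
    (obsCov A σ).trace ≤ L * (gramEig A ⟨0, hL⟩ + σ ^ 2) := by
  have h : ∑ l, gramEig A l ≤ ∑ _l : Fin L, gramEig A ⟨0, hL⟩ :=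
    Finset.sum_le_sum fun l _ => gramEig_le_gramEig_zero A hL l
  rw [sum_gramEig] at h
  simp [obsCov, Matrix.trace_add, Matrix.trace_smul] at h ⊢
  nlinarith

/-- The matrix of the linear estimator `𝔼[X | Y] = Aᵀ Σ_Y⁻¹ Y`. -/
def wiener (A : Matrix (Fin L) (Fin M) ℝ) (σ : ℝ) : Matrix (Fin M) (Fin L) ℝ :=
  Aᵀ * (obsCov A σ)⁻¹

lemma wiener_mul_obsCov (hσ : 0 < σ) : wiener A σ * obsCov A σ = Aᵀ := by
  rw [wiener, Matrix.mul_assoc, Matrix.nonsing_inv_mul _ (isUnit_det_obsCov A hσ), Matrix.mul_one]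

/-- The covariance matrix of the estimation error `X - 𝔼[X | Y]`. -/
def errCov (A : Matrix (Fin L) (Fin M) ℝ) (σ : ℝ) : Matrix (Fin M) (Fin M) ℝ :=
  (1 - wiener A σ * A) * 1 * (1 - wiener A σ * A)ᵀ
    + (-wiener A σ) * (σ ^ 2 • (1 : Matrix (Fin L) (Fin L) ℝ)) * (-wiener A σ)ᵀ

/-- The law of the estimation error `X - 𝔼[X | Y]`. -/
def errLaw (A : Matrix (Fin L) (Fin M) ℝ) (σ : ℝ) : Measure (Vec M) :=
  multivariateGaussian 0 (errCov A σ)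

instance (σ : ℝ) : IsProbabilityMeasure (errLaw A σ) := by
  unfold errLaw; infer_instance

instance (σ : ℝ) : IsProbabilityMeasure (sourceObsLaw A σ) := by
  have := measurable_mulVecE A
  exact Measure.isProbabilityMeasure_map (by fun_prop)

instance (σ : ℝ) : IsProbabilityMeasure (obsLaw A σ) := by
  unfold obsLaw; infer_instance

lemma posSemidef_noise (σ : ℝ) : (σ ^ 2 • (1 : Matrix (Fin L) (Fin L) ℝ)).PosSemidef :=
  Matrix.PosSemidef.one.smul (sq_nonneg σ)

lemma obsLaw_eq (σ : ℝ) : obsLaw A σ = multivariateGaussian 0 (obsCov A σ) := by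
  have hA := measurable_mulVecE A
  have h := multivariateGaussian_prod_map_add Matrix.PosSemidef.one (posSemidef_noise (L := L) σ)
    A 1
  rw [obsLaw, sourceObsLaw, Measure.snd, Measure.map_map (by fun_prop) (by fun_prop)]
  simp only [mulVecE_one] at h
  refine h.trans ?_
  congr 1
  simp [obsCov]

lemma sourceObsLaw_map_err (hσ : 0 < σ) :
    (sourceObsLaw A σ).map (fun p => (p.1 - mulVecE (wiener A σ) p.2, p.2))
      = (errLaw A σ).prod (obsLaw A σ) := by
  have hA := measurable_mulVecE A
  have hW := measurable_mulVecE (wiener A σ)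
  -- Orthogonality principle: the cross-covariance of `X − W Y` and `Y` is `Aᵀ − W Σ_Y = 0`.
  have hc : (1 - wiener A σ * A) * 1 * Aᵀ
      + (-wiener A σ) * (σ ^ 2 • (1 : Matrix (Fin L) (Fin L) ℝ)) *
        (1 : Matrix (Fin L) (Fin L) ℝ)ᵀ = 0 := by
    have h := wiener_mul_obsCov A hσ
    rw [obsCov, Matrix.mul_add] at h
    simp only [Matrix.mul_one, Matrix.transpose_one, Matrix.sub_mul, Matrix.one_mul,
      Matrix.neg_mul, Matrix.mul_assoc]
    rw [← sub_eq_add_neg, sub_sub, h, sub_self]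
  have h := multivariateGaussian_prod_map Matrix.PosSemidef.one (posSemidef_noise σ)
    (1 - wiener A σ * A) (-wiener A σ) A 1 hc
  rw [sourceObsLaw, Measure.map_map (by fun_prop) (by fun_prop)]
  have hY : A * (1 : Matrix (Fin M) (Fin M) ℝ) * Aᵀ
      + 1 * (σ ^ 2 • (1 : Matrix (Fin L) (Fin L) ℝ)) * 1ᵀ = obsCov A σ := by simp [obsCov]
  rw [hY, ← obsLaw_eq] at h
  refine Eq.trans ?_ h
  congr 1
  ext1 p
  simp only [Function.comp, mulVecE_one, matrix_sub_mulVecE, matrix_neg_mulVecE, mulVecE_mul,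
    mulVecE_add]
  congr 1
  abel

lemma sourceObsLaw_eq (hσ : 0 < σ) :
    sourceObsLaw A σ = ((errLaw A σ).prod (obsLaw A σ)).map
      (fun p => (p.1 + mulVecE (wiener A σ) p.2, p.2)) := by
  have hW := measurable_mulVecE (wiener A σ)
  rw [← sourceObsLaw_map_err A hσ, Measure.map_map (by fun_prop) (by fun_prop)]
  conv_lhs => rw [← Measure.map_id (μ := sourceObsLaw A σ)]
  congr 1
  ext1 p
  simp

/-- The reconstruction is drawn from `Y` alone, so the estimation error stays independent of the
pair with law `ρ`, and the integral is one over `errLaw` and `ρ` separately. -/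
lemma lintegral_sourceReconLaw (hσ : 0 < σ) {n : ℕ} (ρ : Measure (Vec L × Vec n))
    [IsProbabilityMeasure ρ] (hρ : ρ.fst = obsLaw A σ) {f : Vec M × Vec n → ℝ≥0∞}
    (hf : Measurable f) :
    ∫⁻ p, f p ∂(sourceReconLaw A σ ρ)
      = ∫⁻ q, ∫⁻ v, f (v + mulVecE (wiener A σ) q.1, q.2) ∂(errLaw A σ) ∂ρ := by
  have hW := measurable_mulVecE (wiener A σ)
  have hk : Measurable fun p : Vec M × Vec L => ∫⁻ w, f (p.1, w) ∂(ρ.condKernel p.2) :=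
    Measurable.lintegral_kernel_prod_right (κ := ρ.condKernel.comap Prod.snd measurable_snd)
      (f := fun (p : Vec M × Vec L) w => f (p.1, w)) (by fun_prop)
  rw [sourceReconLaw, lintegral_map hf (by fun_prop), Measure.lintegral_compProd (by fun_prop)]
  simp only [Kernel.comap_apply]
  rw [sourceObsLaw_eq A hσ, lintegral_map hk (by fun_prop),
    lintegral_prod _ (Measurable.aemeasurable (f := fun p : Vec M × Vec L =>
      ∫⁻ w, f (p.1 + mulVecE (wiener A σ) p.2, w) ∂(ρ.condKernel p.2))
      (hk.comp (f := fun p : Vec M × Vec L => (p.1 + mulVecE (wiener A σ) p.2, p.2))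
        (by fun_prop))), lintegral_lintegral_swap
      (μ := ρ) (ν := errLaw A σ)
      (f := fun (q : Vec L × Vec n) v => f (v + mulVecE (wiener A σ) q.1, q.2)) (by fun_prop)]
  refine lintegral_congr fun v => ?_
  -- For a fixed error `v`, the marginal and conditional kernel of `ρ` recombine into `ρ`.
  have h := Measure.lintegral_compProd (μ := ρ.fst) (κ := ρ.condKernel)
    (f := fun q : Vec L × Vec n => f (v + mulVecE (wiener A σ) q.1, q.2)) (by fun_prop)
  rw [ρ.disintegrate ρ.condKernel, hρ] at h
  exact h.symm

/-- The total distortion splits into the minimum mean square error of estimating `X` from `Y` and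
the distortion with which `𝔼[X | Y]` is reproduced. -/
lemma distortion_sourceReconLaw (hσ : 0 < σ) {n : ℕ} (ρ : Measure (Vec L × Vec n))
    [IsProbabilityMeasure ρ] (hρ : ρ.fst = obsLaw A σ) {g : Vec n → Vec M} (hg : Measurable g) :
    distortion (sourceReconLaw A σ ρ) g = (∫⁻ v, ‖v‖ₑ ^ 2 ∂(errLaw A σ)
      + ∫⁻ q, ‖mulVecE (wiener A σ) q.1 - g q.2‖ₑ ^ 2 ∂ρ) / M := by
  have hW := measurable_mulVecE (wiener A σ)
  rw [distortion, lintegral_sourceReconLaw A hσ ρ hρ (by fun_prop)]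
  simp_rw [add_sub_assoc, errLaw, lintegral_sq_enorm_add_multivariateGaussian]
  rw [lintegral_add_left measurable_const]
  simp

lemma le_iDRF (hσ : 0 < σ) (R : ℝ) :
    (∫⁻ v, ‖v‖ₑ ^ 2 ∂(errLaw A σ)) / M ≤ iDRF A σ R := by
  refine le_iInf fun ρ => le_iInf fun _ => le_iInf fun hρ => le_iInf fun _ => ?_
  rw [distortion_sourceReconLaw A hσ ρ hρ measurable_id]
  gcongr
  exact le_self_add

/-- In eigenvalues this is `λ / (λ + σ²)² ≤ 1 / (4σ²)`. Without diagonalizing: for `y = a + b` with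
`a = A Aᵀ u` and `b = σ² u`, one has `‖y‖² = ‖a − b‖² + 4⟨a, b⟩ ≥ 4σ² ‖Aᵀ u‖²`, and `Aᵀ u = W y`. -/
lemma norm_sq_wiener_le (hσ : 0 < σ) (y : Vec L) :
    ‖mulVecE (wiener A σ) y‖ ^ 2 ≤ 1 / (4 * σ ^ 2) * ‖y‖ ^ 2 := by
  set u := mulVecE (obsCov A σ)⁻¹ y with hu
  have hy : y = mulVecE A (mulVecE Aᵀ u) + σ ^ 2 • u := by
    have : mulVecE (obsCov A σ) u = y := by
      rw [hu, ← mulVecE_mul, Matrix.mul_nonsing_inv _ (isUnit_det_obsCov A hσ), mulVecE_one]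
    rw [← this, obsCov, matrix_add_mulVecE, mulVecE_mul, matrix_smul_mulVecE, mulVecE_one]
  have hw : mulVecE (wiener A σ) y = mulVecE Aᵀ u := by rw [wiener, mulVecE_mul]
  rw [hw]
  have h1 := norm_add_sq_real (mulVecE A (mulVecE Aᵀ u)) (σ ^ 2 • u)
  have h2 := norm_sub_sq_real (mulVecE A (mulVecE Aᵀ u)) (σ ^ 2 • u)
  have h3 : inner ℝ (mulVecE A (mulVecE Aᵀ u)) (σ ^ 2 • u) = σ ^ 2 * ‖mulVecE Aᵀ u‖ ^ 2 := by
    rw [inner_smul_right, inner_mulVecE_left, real_inner_self_eq_norm_sq]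
  rw [← hy, h3] at h1
  rw [h3] at h2
  have h4 := sq_nonneg ‖mulVecE A (mulVecE Aᵀ u) - σ ^ 2 • u‖
  rw [div_mul_eq_mul_div, le_div_iff₀ (by positivity)]
  nlinarith

lemma enorm_sq_wiener_le (hσ : 0 < σ) (y : Vec L) :
    ‖mulVecE (wiener A σ) y‖ₑ ^ 2 ≤ ENNReal.ofReal (1 / (4 * σ ^ 2)) * ‖y‖ₑ ^ 2 := by
  rw [← ofReal_norm, ← ofReal_norm, ← ENNReal.ofReal_pow (norm_nonneg _),
    ← ENNReal.ofReal_pow (norm_nonneg _), ← ENNReal.ofReal_mul (by positivity)]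
  exact ENNReal.ofReal_le_ofReal (norm_sq_wiener_le A hσ y)

lemma ceDRF_le (hσ : 0 < σ) (ρ : Measure (Vec L × Vec L)) [IsProbabilityMeasure ρ]
    (hρ : ρ.fst = obsLaw A σ) :
    ceDRF A σ ρ ≤ (∫⁻ v, ‖v‖ₑ ^ 2 ∂(errLaw A σ)
      + ENNReal.ofReal (1 / (4 * σ ^ 2)) * ∫⁻ q, ‖q.1 - q.2‖ₑ ^ 2 ∂ρ) / M := by
  -- Plug-in estimator: apply the Wiener matrix to `Ŷ` as if it were `Y`.
  refine (iInf₂_le (mulVecE (wiener A σ)) (measurable_mulVecE _)).trans ?_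
  rw [distortion_sourceReconLaw A hσ ρ hρ (measurable_mulVecE _),
    ← lintegral_const_mul _ (by fun_prop)]
  gcongr with q
  rw [← mulVecE_sub]
  exact enorm_sq_wiener_le A hσ _

lemma iDRF_ne_top (hM : 0 < M) (hσ : 0 < σ) (R : ℝ) : iDRF A σ R ≠ ⊤ := by
  have hW := measurable_mulVecE (wiener A σ)
  -- The constant reconstruction `0` carries no information, so it is admissible at every rate.
  let ρ : Measure (Vec L × Vec M) := (obsLaw A σ).prod (Measure.dirac 0)
  have h1 : ρ.fst = obsLaw A σ := Measure.fst_prod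
  have h2 : mutualInfo ρ ≤ ENNReal.ofReal R := by
    rw [mutualInfo, h1, show ρ.snd = Measure.dirac 0 from Measure.snd_prod, klDiv_self]
    simp
  refine ne_top_of_le_ne_top ?_ (iInf₂_le_of_le ρ inferInstance (iInf₂_le h1 h2))
  rw [distortion_sourceReconLaw A hσ ρ h1 measurable_id]
  refine ENNReal.div_ne_top (ENNReal.add_ne_top.2
    ⟨lintegral_sq_enorm_multivariateGaussian_ne_top _, ?_⟩) (by simpa using hM.ne')
  rw [lintegral_prod _ (by fun_prop)]
  simp only [lintegral_dirac, id, sub_zero]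
  refine ne_top_of_le_ne_top ?_ (lintegral_mono fun y => enorm_sq_wiener_le A hσ y)
  rw [lintegral_const_mul _ (by fun_prop), obsLaw_eq]
  exact ENNReal.mul_ne_top ENNReal.ofReal_ne_top (lintegral_sq_enorm_multivariateGaussian_ne_top _)

/-- A law that reproduces the observation within distortion `d` has a gap of at most
`d / (4 σ² M)`. -/
lemma ceDRF_ne_top_and_gap_le (hM : 0 < M) (hσ : 0 < σ) (R : ℝ) (ρ : Measure (Vec L × Vec L))
    [IsProbabilityMeasure ρ] (hρ : ρ.fst = obsLaw A σ) {d : ℝ} (hd : 0 ≤ d)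
    (h : ∫⁻ q, ‖q.1 - q.2‖ₑ ^ 2 ∂ρ ≤ ENNReal.ofReal d) :
    ceDRF A σ ρ ≠ ⊤ ∧ gap A σ R ρ ≤ 1 / (4 * σ ^ 2) * d / M := by
  have hM' : (M : ℝ≥0∞) ≠ 0 := by simpa using hM.ne'
  have hv := lintegral_sq_enorm_multivariateGaussian_ne_top (errCov A σ)
  have h1 : ceDRF A σ ρ ≤ (∫⁻ v, ‖v‖ₑ ^ 2 ∂(errLaw A σ)) / M
      + ENNReal.ofReal (1 / (4 * σ ^ 2) * d / M) := by
    refine (ceDRF_le A hσ ρ hρ).trans ?_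
    rw [ENNReal.add_div, ENNReal.ofReal_div_of_pos (y := (M : ℝ)) (by exact_mod_cast hM),
      ENNReal.ofReal_mul (q := d) (by positivity), ENNReal.ofReal_natCast]
    gcongr
  have hv' : (∫⁻ v, ‖v‖ₑ ^ 2 ∂(errLaw A σ)) / M ≠ ⊤ := ENNReal.div_ne_top hv hM'
  have h2 : ceDRF A σ ρ ≤ iDRF A σ R + ENNReal.ofReal (1 / (4 * σ ^ 2) * d / M) :=
    h1.trans (by gcongr; exact le_iDRF A hσ R)
  have h3 : iDRF A σ R + ENNReal.ofReal (1 / (4 * σ ^ 2) * d / M) ≠ ⊤ :=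
    ENNReal.add_ne_top.2 ⟨iDRF_ne_top A hM hσ R, ENNReal.ofReal_ne_top⟩
  refine ⟨ne_top_of_le_ne_top h3 h2, ?_⟩
  have h4 := ENNReal.toReal_mono h3 h2
  rw [ENNReal.toReal_add (iDRF_ne_top A hM hσ R) ENNReal.ofReal_ne_top,
    ENNReal.toReal_ofReal (by positivity)] at h4
  rw [gap]
  linarith

end Model

end RemoteCoding

namespace RemoteCoding

variable {M L : ℕ}

/-! ### Distortion of the backward Gaussian channel -/

section Backward

variable (A : Matrix (Fin L) (Fin M) ℝ) {σ θ : ℝ} {U : Matrix (Fin L) (Fin L) ℝ}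

lemma waterFill_nonneg (hθ : 0 < θ) (l : Fin L) : 0 ≤ waterFill A σ θ l :=
  le_min (add_nonneg (gramEig_nonneg A l) (sq_nonneg σ)) hθ.le

lemma posSemidef_diagonal_waterFill (hθ : 0 < θ) :
    (Matrix.diagonal (waterFill A σ θ)).PosSemidef :=
  Matrix.PosSemidef.diagonal fun l => waterFill_nonneg A hθ l

/-- The matrix equals `U diag(λ_l + σ² − D_l) Uᵀ`, and `D_l ≤ λ_l + σ²`. -/
lemma posSemidef_obsCov_sub (hU : Diagonalizes A σ U) :
    (obsCov A σ - U * Matrix.diagonal (waterFill A σ θ) * Uᵀ).PosSemidef := by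
  have h1 : U * Uᵀ = 1 := by
    simpa [Matrix.star_eq_conjTranspose] using (Matrix.mem_unitaryGroup_iff.1 hU.1)
  have h2 : obsCov A σ = U * Matrix.diagonal (fun l => gramEig A l + σ ^ 2) * Uᵀ := by
    rw [← hU.2]
    calc obsCov A σ = (U * Uᵀ) * obsCov A σ * (U * Uᵀ) := by
          rw [h1, Matrix.one_mul, Matrix.mul_one]
      _ = _ := by simp only [Matrix.mul_assoc]
  have h3 : (Matrix.diagonal fun l => gramEig A l + σ ^ 2 - waterFill A σ θ l).PosSemidef :=
    Matrix.PosSemidef.diagonal fun l => sub_nonneg.2 (min_le_left _ _)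
  have h4 := h3.mul_mul_conjTranspose_same U
  rw [Matrix.conjTranspose_eq_transpose_of_trivial, ← Matrix.diagonal_sub, Matrix.mul_sub,
    Matrix.sub_mul, ← h2] at h4
  exact h4

lemma fst_backwardLaw (hθ : 0 < θ) (hU : Diagonalizes A σ U) :
    (backwardLaw A σ θ U).fst = obsLaw A σ := by
  have hm := measurable_mulVecE U
  have h := multivariateGaussian_prod_map_add (posSemidef_obsCov_sub A (θ := θ) hU)
    (posSemidef_diagonal_waterFill A (σ := σ) hθ) 1 U
  simp only [mulVecE_one, Matrix.one_mul, Matrix.transpose_one, Matrix.mul_one,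
    sub_add_cancel] at h
  rw [backwardLaw, Measure.fst, Measure.map_map (by fun_prop) (by fun_prop), obsLaw_eq, ← h]
  rfl

lemma lintegral_backwardLaw (hθ : 0 < θ) (hU : Diagonalizes A σ U) :
    ∫⁻ q, ‖q.1 - q.2‖ₑ ^ 2 ∂(backwardLaw A σ θ U)
      = ENNReal.ofReal (∑ l, waterFill A σ θ l) := by
  have hm := measurable_mulVecE U
  rw [backwardLaw, lintegral_map (by fun_prop) (by fun_prop)]
  have h (p : Vec L × Vec L) : ‖p.1 + mulVecE U p.2 - p.1‖ₑ = ‖p.2‖ₑ := by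
    rw [add_sub_cancel_left, ← ofReal_norm, ← ofReal_norm,
      norm_mulVecE_of_mem_orthogonalGroup hU.1]
  simp_rw [h]
  rw [lintegral_prod _ (by fun_prop)]
  simp only [lintegral_const, measure_univ, mul_one]
  rw [lintegral_sq_enorm_multivariateGaussian (posSemidef_diagonal_waterFill A hθ),
    Matrix.trace_diagonal]

/-- Both the rate and the distortion of a coordinate increase with `λ_l`, so replacing every `λ_l`
by `λ₁` bounds both sums from above by `L` equal terms. -/
lemma sum_waterFill_le (hL : 0 < L) (hσ : 0 < σ) {R : ℝ} (h : IsWaterLevel A σ R θ) :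
    ∑ l, waterFill A σ θ l ≤ L * (gramEig A ⟨0, hL⟩ + σ ^ 2) * 2 ^ (-2 * R / (L : ℝ)) := by
  obtain ⟨hθ, hR⟩ := h
  have hL' : (0 : ℝ) < L := by exact_mod_cast hL
  set s := gramEig A ⟨0, hL⟩ + σ ^ 2 with hs
  have hs0 : 0 < s := add_pos_of_nonneg_of_pos (gramEig_nonneg A _) (by positivity)
  have hle (l : Fin L) : gramEig A l + σ ^ 2 ≤ s :=
    add_le_add_left (gramEig_le_gramEig_zero A hL l) _
  have hsum (f : Fin L → ℝ) (c : ℝ) (hf : ∀ l, f l ≤ c) : ∑ l, f l ≤ L * c := by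
    simpa using Finset.sum_le_sum fun l (_ : l ∈ Finset.univ) => hf l
  have hRle : R ≤ L * (1 / 2 * Real.logb 2 (max 1 (s / θ))) := by
    rw [← hR]
    refine hsum _ _ fun l => ?_
    gcongr
    · norm_num
    · exact hle l
  have hmin : ∑ l, waterFill A σ θ l ≤ L * min s θ :=
    hsum _ _ fun l => min_le_min_right θ (hle l)
  -- Here `min s θ = s / max 1 (s / θ)`, and the rate bound controls `max 1 (s / θ)` from below.
  have hpow : min s θ ≤ s * 2 ^ (-2 * R / (L : ℝ)) := by
    have e1 : -2 * R / (L : ℝ) ≥ -Real.logb 2 (max 1 (s / θ)) := by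
      rw [ge_iff_le, le_div_iff₀ hL']
      nlinarith
    have e2 : (2 : ℝ) ^ (-Real.logb 2 (max 1 (s / θ))) ≤ 2 ^ (-2 * R / (L : ℝ)) :=
      Real.rpow_le_rpow_of_exponent_le one_le_two e1
    rw [Real.rpow_neg zero_le_two, Real.rpow_logb two_pos (by norm_num) (by positivity)] at e2
    refine le_trans ?_ (mul_le_mul_of_nonneg_left e2 hs0.le)
    rcases le_total s θ with h | h
    · rw [max_eq_left ((div_le_one hθ).2 h)]
      simp
    · rw [max_eq_right ((one_le_div hθ).2 h), min_eq_right h]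
      field_simp
      exact le_rfl
  calc _ ≤ L * min s θ := hmin
    _ ≤ L * (s * 2 ^ (-2 * R / (L : ℝ))) := by gcongr
    _ = _ := by ring

end Backward

/-! ### A test channel bounding the distortion-rate function of `Y` -/

section Achievability

variable (A : Matrix (Fin L) (Fin M) ℝ) {σ : ℝ}

open scoped MatrixOrder in
/-- The Gaussian test channel that spends the same rate on every coordinate of the whitened
observation reproduces the observation within `t² 𝔼 ‖Y‖²`. -/
lemma obsDRF_le_of_rate (σ R : ℝ) {s t : ℝ} (ht : 0 < t) (hst : s ^ 2 + t ^ 2 = 1)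
    (hR : L * ENNReal.ofReal (-Real.log t) / ENNReal.ofReal (Real.log 2) ≤ ENNReal.ofReal R) :
    obsDRF A σ R ≤ ENNReal.ofReal (t ^ 2) * ∫⁻ y, ‖y‖ₑ ^ 2 ∂(obsLaw A σ) := by
  -- `B` is the square root of `Σ_Y`: it maps whitened coordinates to `Y`.
  set B : Vec L →L[ℝ] Vec L := Matrix.toEuclideanCLM (𝕜 := ℝ) (CFC.sqrt (obsCov A σ))
  have hobs : obsLaw A σ = (stdGaussian (Vec L)).map B := by
    rw [obsLaw_eq, multivariateGaussian]
    simp only [zero_add]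
    rfl
  let ρ : Measure (Vec L × Vec L) := (stdPair L s t).map (Prod.map B (fun x => s • B x))
  have hm : Measurable (Prod.map B (fun x => s • B x)) := by fun_prop
  have : IsProbabilityMeasure ρ := Measure.isProbabilityMeasure_map hm.aemeasurable
  have h1 : ρ.fst = obsLaw A σ := by
    rw [hobs, ← fst_stdPair L s t, Measure.fst, Measure.map_map measurable_fst hm, Measure.fst,
      Measure.map_map (by fun_prop) measurable_fst]
    rfl
  have h2 : mutualInfo ρ ≤ ENNReal.ofReal R :=
    (mutualInfo_map_le _ (by fun_prop) (by fun_prop)).trans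
      ((mutualInfo_stdPair_le L ht hst).trans hR)
  refine (iInf₂_le_of_le ρ this (iInf₂_le h1 h2)).trans (le_of_eq ?_)
  have h3 : t ^ 2 + (-s) ^ 2 = 1 := by rw [← hst]; ring
  rw [lintegral_map (by fun_prop) hm, stdPair, lintegral_map (by fun_prop) (by fun_prop), hobs,
    lintegral_map (by fun_prop) (by fun_prop)]
  conv_rhs => rw [← stdGaussian_prod_map_add h3, lintegral_map (by fun_prop) (by fun_prop),
    ← lintegral_const_mul _ (by fun_prop)]
  refine lintegral_congr fun p => ?_
  -- With `Y = B G` and `Ŷ = s B (s G + t G')`, the error is `t B (t G − s G')`, where `t G − s G'`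
  -- is again standard Gaussian.
  have e : B p.1 - s • B (s • p.1 + t • p.2) = t • B (t • p.1 + (-s) • p.2) := by
    have : s ^ 2 = 1 - t ^ 2 := by linarith
    simp only [map_add, map_smul, smul_add, smul_smul, ← pow_two, this]
    module
  simp only [Prod.map]
  rw [e, enorm_smul, mul_pow, Real.enorm_eq_ofReal ht.le, ENNReal.ofReal_pow ht.le]

lemma obsDRF_le (hL : 0 < L) (hσ : 0 < σ) {R : ℝ} (hR : 0 ≤ R) :
    obsDRF A σ R
      ≤ ENNReal.ofReal (L * (gramEig A ⟨0, hL⟩ + σ ^ 2) * 2 ^ (-2 * R / (L : ℝ))) := by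
  have hL' : (0 : ℝ) < L := by exact_mod_cast hL
  have hl2 : 0 < Real.log 2 := Real.log_pos one_lt_two
  -- This choice makes `-L log₂ t = R`, so the channel uses exactly the allowed rate.
  set t : ℝ := 2 ^ (-R / (L : ℝ)) with ht
  have ht0 : 0 < t := by positivity
  have ht1 : t ≤ 1 :=
    Real.rpow_le_one_of_one_le_of_nonpos one_le_two
      (div_nonpos_of_nonpos_of_nonneg (neg_nonpos.2 hR) hL'.le)
  have ht2 : t ^ 2 = 2 ^ (-2 * R / (L : ℝ)) := by
    rw [ht, ← Real.rpow_natCast, ← Real.rpow_mul zero_le_two]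
    congr 1
    push_cast
    ring
  have hst : √(1 - t ^ 2) ^ 2 + t ^ 2 = 1 := by
    rw [Real.sq_sqrt (by nlinarith)]
    ring
  refine (obsDRF_le_of_rate A σ R ht0 hst ?_).trans ?_
  · rw [ht, Real.log_rpow two_pos, ← ENNReal.ofReal_natCast, ← ENNReal.ofReal_mul hL'.le,
      ← ENNReal.ofReal_div_of_pos hl2]
    refine ENNReal.ofReal_le_ofReal (le_of_eq ?_)
    field_simp
  · rw [obsLaw_eq, lintegral_sq_enorm_multivariateGaussian (posDef_obsCov A hσ).posSemidef,
      ← ENNReal.ofReal_mul (by positivity), ← ht2, mul_comm]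
    refine ENNReal.ofReal_le_ofReal ?_
    gcongr
    exact trace_obsCov_le A σ hL

end Achievability

end RemoteCoding

end

theorem theorem1 (M L : ℕ) (hM : 0 < M) (hL : 0 < L)
    (A : Matrix (Fin L) (Fin M) ℝ) (hA : A.rank = min M L)
    (σ : ℝ) (hσ : 0 < σ) (R : ℝ) (hR : 0 ≤ R) :
    RemoteCoding.iDRF A σ R ≠ ⊤ ∧
    (∀ (ρ : Measure (RemoteCoding.Vec L × RemoteCoding.Vec L)) [IsProbabilityMeasure ρ],
      RemoteCoding.IsLocallyOptimal A σ R ρ →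
        RemoteCoding.ceDRF A σ ρ ≠ ⊤ ∧
        RemoteCoding.gap A σ R ρ ≤
          (L : ℝ) / M * ((RemoteCoding.gramEig A ⟨0, hL⟩ + σ ^ 2) / (4 * σ ^ 2)) *
            (2 : ℝ) ^ (-2 * R / (L : ℝ))) ∧
    (∀ (θ : ℝ) (U : Matrix (Fin L) (Fin L) ℝ),
      RemoteCoding.IsWaterLevel A σ R θ → RemoteCoding.Diagonalizes A σ U →
        RemoteCoding.ceDRF A σ (RemoteCoding.backwardLaw A σ θ U) ≠ ⊤ ∧
        RemoteCoding.gap A σ R (RemoteCoding.backwardLaw A σ θ U) ≤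
          (L : ℝ) / M * ((RemoteCoding.gramEig A ⟨0, hL⟩ + σ ^ 2) / (4 * σ ^ 2)) *
            (2 : ℝ) ^ (-2 * R / (L : ℝ))) := by
  have hM' : (0 : ℝ) < M := by exact_mod_cast hM
  -- Both kinds of law enter only through the marginal of `Y` and the bound on `𝔼‖Y − Ŷ‖²`.
  have hbound (ρ : Measure (RemoteCoding.Vec L × RemoteCoding.Vec L)) [IsProbabilityMeasure ρ]
      (hρ : ρ.fst = RemoteCoding.obsLaw A σ)
      (h : ∫⁻ q, ‖q.1 - q.2‖ₑ ^ 2 ∂ρ ≤ ENNReal.ofReal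
        (L * (RemoteCoding.gramEig A ⟨0, hL⟩ + σ ^ 2) * 2 ^ (-2 * R / (L : ℝ)))) :
      RemoteCoding.ceDRF A σ ρ ≠ ⊤ ∧
        RemoteCoding.gap A σ R ρ ≤
          (L : ℝ) / M * ((RemoteCoding.gramEig A ⟨0, hL⟩ + σ ^ 2) / (4 * σ ^ 2)) *
            (2 : ℝ) ^ (-2 * R / (L : ℝ)) := by
    have hs := RemoteCoding.gramEig_nonneg A ⟨0, hL⟩
    have h' := RemoteCoding.ceDRF_ne_top_and_gap_le A hM hσ R ρ hρ (by positivity) h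
    refine ⟨h'.1, h'.2.trans (le_of_eq ?_)⟩
    field_simp
  refine ⟨RemoteCoding.iDRF_ne_top A hM hσ R, fun ρ _ hρ => ?_, fun θ U hθ hU => ?_⟩
  · exact hbound ρ hρ.fst_eq (hρ.distortion_eq.trans_le (RemoteCoding.obsDRF_le A hL hσ hR))
  · refine hbound _ (RemoteCoding.fst_backwardLaw A hθ.1 hU) ?_
    rw [RemoteCoding.lintegral_backwardLaw A hθ.1 hU]
    exact ENNReal.ofReal_le_ofReal (RemoteCoding.sum_waterFill_le A hL hσ hθ)
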